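/- **Definitions.** Let $(M,g)$ be a Riemannian manifold with Levi-Civita connection $\nabla$. An *almost contact metric structure* on $(M,g)$ consists of a unit vector field $\xi$, its dual $1$-form $\eta=g(\xi,\cdot)$ and an endomorphism $\varphi$ of the tangent bundle such that $\varphi(\xi)=0$, $\varphi^2=-\mathrm{Id}+\eta\otimes\xi$ and $g(\varphi X,\varphi Y)=g(X,Y)-\eta(X)\eta(Y)$; its fundamental form is $\Phi(X,Y)=g(X,\varphi Y)$. The structure is *nearly cosymplectic* if $$(\nabla_X\varphi)(X)=0\quad\text{for all vector fields }X,$$ and *quasi-cosymplectic* if $$(\nabla_X\varphi)(Y)+(\nabla_{\varphi X}\varphi)(\varphi Y)=\eta(Y)\,\nabla_{\varphi X}\xi\quad\text{for all vector fields }X,Y.$$ In dimension $5$, a coframe $(e_1,\dots,e_5)$ is *adapted* if it is orthonormal, $\Phi=e_1\wedge e_2+e_3\wedge e_4$ and $\eta=e_5$. **The manifolds $M^5(a_1,a_2,a_3,a_4)$.** Let $a_1,a_2,a_3,a_4\in\mathbb R$ with $a_1a_4=a_2a_3$. Let $G$ be a $6$-dimensional Lie group with a basis $e_1,\dots,e_5,A_2$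 of its left-invariant $1$-forms satisfying $$\begin{aligned} de_1&=A_2\wedge e_2-(2a_1+a_3)\,e_3\wedge e_5-(2a_2+a_4)\,e_4\wedge e_5,\\ de_2&=-A_2\wedge e_1+(2a_1+a_3)\,e_4\wedge e_5-(2a_2+a_4)\,e_3\wedge e_5,\\ de_3&=-A_2\wedge e_4+(2a_1+a_3)\,e_1\wedge e_5+(2a_2+a_4)\,e_2\wedge e_5,\\ de_4&=A_2\wedge e_3-(2a_1+a_3)\,e_2\wedge e_5+(2a_2+a_4)\,e_1\wedge e_5,\\ de_5&=-2(a_1-a_3)(e_1\wedge e_3-e_2\wedge e_4)-2(a_2-a_4)(e_1\wedge e_4+e_2\wedge e_3),\\ dA_2&=-2\big((a_1-a_3)(2a_1+a_3)+(a_2-a_4)(2a_2+a_4)\big)(e_1\wedge e_2-e_3\wedge e_4). \end{aligned}$$ Let $M^5$ be a non-empty $5$-dimensional (immersed) submanifold of $G$ such that the restrictions of $e_1,\dots,e_5$ to $M^5$ are linearly independent at every point. Then $M^5(a_1,a_2,a_3,a_4)$ denotes $M^5$ with the Riemannian metric and the almost contact metric structure for which the restricted forms $(e_1,\dots,e_5)$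 are an adapted coframe. **Proposition.** The almost contact metric manifold $M^5(a_1,a_2,a_3,a_4)$ is nearly cosymplectic if and only if $a_1=-5a_3$ and $a_2=-5a_4$. It is quasi-cosymplectic if and only if $a_1=-2a_3$ and $a_2=-2a_4$. -/

import Mathlib

open Bundle Manifold
open scoped ContDiff

noncomputable section

section OneForms

variable {E : Type*} [NormedAddCommGroup E] [NormedSpace ℝ E]
  {H : Type*} [TopologicalSpace H] (I : ModelWithCorners ℝ E H)
  {N : Type*} [TopologicalSpace N] [ChartedSpace H N]

/-- Smoothness of a vector field, as a section of the tangent bundle. -/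
def IsSmoothVectorField [IsManifold I ∞ N] (X : (x : N) → TangentSpace I x) : Prop :=
  ContMDiff I I.tangent ∞ (fun x ↦ (⟨x, X x⟩ : TangentBundle I N))

/-- Smoothness of a field of covectors, as a section of the cotangent bundle. -/
def IsSmoothOneForm [IsManifold I ∞ N] (w : (x : N) → TangentSpace I x →L[ℝ] ℝ) : Prop :=
  ContMDiff I (I.prod 𝓘(ℝ, E →L[ℝ] ℝ)) ∞
    (fun x ↦ TotalSpace.mk' (E →L[ℝ] ℝ)
      (E := fun x : N ↦ TangentSpace I x →L[ℝ] Bundle.Trivial N ℝ x) x (w x))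

variable {I}

/-- The wedge product of two covectors, `(a ∧ b)(u, v) = a(u) b(v) - a(v) b(u)`. -/
def wedge {x : N} (a b : TangentSpace I x →L[ℝ] ℝ) (u v : TangentSpace I x) : ℝ :=
  a u * b v - a v * b u

/-- `dw = B`, where the exterior derivative of the one-form `w` is given by
`dw(X, Y) = X(w(Y)) - Y(w(X)) - w([X, Y])`. -/
def IsExteriorDerivative [IsManifold I ∞ N] (w : (x : N) → TangentSpace I x →L[ℝ] ℝ)
    (B : (x : N) → TangentSpace I x → TangentSpace I x → ℝ) : Prop :=
  ∀ (x : N) (X Y : (y : N) → TangentSpace I y), MDiffAt (T% X) x → MDiffAt (T% Y) x →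
    mvfderiv I (fun y ↦ w y (Y y)) x (X x) - mvfderiv I (fun y ↦ w y (X y)) x (Y x)
      - w x (VectorField.mlieBracket I X Y x) = B x (X x) (Y x)

end OneForms

section LieGroups

variable {E : Type*} [NormedAddCommGroup E] [NormedSpace ℝ E]
  {H : Type*} [TopologicalSpace H] (I : ModelWithCorners ℝ E H)
  (G : Type*) [TopologicalSpace G] [ChartedSpace H G] [Group G] [LieGroup I ∞ G]

/-- The vector space of left-invariant (smooth) one-forms on a Lie group. -/
def leftInvariantOneForms : Submodule ℝ ((x : G) → TangentSpace I x →L[ℝ] ℝ) where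
  carrier := {w | IsSmoothOneForm I w ∧
    ∀ (g h : G) (v : TangentSpace I h), w (g * h) (mfderiv I I (fun y ↦ g * y) h v) = w h v}
  add_mem' {w w'} hw hw' := by
    refine ⟨ContMDiff.add_section hw.1 hw'.1, fun g h v ↦ ?_⟩
    have h1 := hw.2 g h v
    have h2 := hw'.2 g h v
    change w (g * h) _ + w' (g * h) _ = w h v + w' h v
    rw [h1, h2]
  zero_mem' := by
    refine ⟨?_, fun g h v ↦ rfl⟩
    exact Bundle.contMDiff_zeroSection ℝ
      (fun x : G ↦ TangentSpace I x →L[ℝ] Bundle.Trivial G ℝ x)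
  smul_mem' c w hw := by
    refine ⟨ContMDiff.const_smul_section hw.1, fun g h v ↦ ?_⟩
    have h1 := hw.2 g h v
    change c • w (g * h) _ = c • w h v
    rw [h1]

end LieGroups

section AlmostContact

variable (n : ℕ) (M : Type*) [TopologicalSpace M] [ChartedSpace (EuclideanSpace ℝ (Fin n)) M]
  [IsManifold (𝓡 n) ∞ M] [RiemannianBundle (fun x : M ↦ TangentSpace (𝓡 n) x)]
  [IsContMDiffRiemannianBundle (𝓡 n) ∞ (EuclideanSpace ℝ (Fin n))
    (fun x : M ↦ TangentSpace (𝓡 n) x)]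

/-- An almost contact metric structure on a Riemannian manifold `(M, g)`: a unit vector field `ξ`
and an endomorphism field `φ` of the tangent bundle, both smooth, with `φ ξ = 0`,
`φ² = - Id + η ⊗ ξ` and `g(φ X, φ Y) = g(X, Y) - η(X) η(Y)`, where `η = g(ξ, ·)`. -/
structure AlmostContactMetricStructure where
  /-- the unit vector field -/
  xi : (x : M) → TangentSpace (𝓡 n) x
  /-- the endomorphism field -/
  phi : (x : M) → TangentSpace (𝓡 n) x →L[ℝ] TangentSpace (𝓡 n) x
  smooth_xi : IsSmoothVectorField (𝓡 n) xi
  smooth_phi : ContMDiff (𝓡 n)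
    ((𝓡 n).prod 𝓘(ℝ, EuclideanSpace ℝ (Fin n) →L[ℝ] EuclideanSpace ℝ (Fin n))) ∞
    (fun x ↦ TotalSpace.mk' (EuclideanSpace ℝ (Fin n) →L[ℝ] EuclideanSpace ℝ (Fin n))
      (E := fun x : M ↦ TangentSpace (𝓡 n) x →L[ℝ] TangentSpace (𝓡 n) x) x (phi x))
  norm_xi (x : M) : inner ℝ (xi x) (xi x) = 1
  phi_xi (x : M) : phi x (xi x) = 0
  phi_phi (x : M) (u : TangentSpace (𝓡 n) x) :
    phi x (phi x u) = -u + inner ℝ (xi x) u • xi x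
  inner_phi_phi (x : M) (u v : TangentSpace (𝓡 n) x) :
    inner ℝ (phi x u) (phi x v) = inner ℝ u v - inner ℝ (xi x) u * inner ℝ (xi x) v

variable {n M}

/-- A Levi-Civita connection of the Riemannian manifold: metric and torsion-free. -/
def IsLeviCivita (nabla : CovariantDerivative (𝓡 n) (EuclideanSpace ℝ (Fin n))
    (fun x : M ↦ TangentSpace (𝓡 n) x)) : Prop :=
  haveI : IsContMDiffRiemannianBundle (𝓡 n) 1 (EuclideanSpace ℝ (Fin n))
      (fun x : M ↦ TangentSpace (𝓡 n) x) := IsContMDiffRiemannianBundle.of_le (n := ∞) (by simp)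
  nabla.IsMetricCompatible ∧ nabla.torsion = 0

/-- The covariant derivative `(∇_X φ)(Y) = ∇_X (φ Y) - φ (∇_X Y)` of an endomorphism field.
(In Mathlib's convention `nabla Y x (X x)` is `∇_X Y` at `x`.) -/
def covDerivEndo (nabla : CovariantDerivative (𝓡 n) (EuclideanSpace ℝ (Fin n))
    (fun x : M ↦ TangentSpace (𝓡 n) x))
    (phi : (x : M) → TangentSpace (𝓡 n) x →L[ℝ] TangentSpace (𝓡 n) x)
    (X Y : (x : M) → TangentSpace (𝓡 n) x) (x : M) : TangentSpace (𝓡 n) x :=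
  nabla (fun y ↦ phi y (Y y)) x (X x) - phi x (nabla Y x (X x))

namespace AlmostContactMetricStructure

variable (S : AlmostContactMetricStructure n M)

/-- The one-form `η` dual to `ξ`. -/
def eta (x : M) : TangentSpace (𝓡 n) x →L[ℝ] ℝ := innerSL ℝ (S.xi x)

/-- The fundamental form `Φ(X, Y) = g(X, φ Y)`. -/
def fundamentalForm (x : M) (u v : TangentSpace (𝓡 n) x) : ℝ := inner ℝ u (S.phi x v)

/-- The image `φ X` of a vector field `X`. -/
def phiField (X : (x : M) → TangentSpace (𝓡 n) x) (x : M) : TangentSpace (𝓡 n) x :=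
  S.phi x (X x)

/-- `(∇_X φ)(X) = 0` for all vector fields `X`, with `∇` the Levi-Civita connection. -/
def IsNearlyCosymplectic : Prop :=
  ∃ nabla : CovariantDerivative (𝓡 n) (EuclideanSpace ℝ (Fin n))
      (fun x : M ↦ TangentSpace (𝓡 n) x), IsLeviCivita nabla ∧
    ∀ X : (x : M) → TangentSpace (𝓡 n) x, IsSmoothVectorField (𝓡 n) X →
      ∀ x, covDerivEndo nabla S.phi X X x = 0

/-- `(∇_X φ)(Y) + (∇_{φ X} φ)(φ Y) = η(Y) ∇_{φ X} ξ` for all vector fields `X`, `Y`, with `∇` the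
Levi-Civita connection. -/
def IsQuasiCosymplectic : Prop :=
  ∃ nabla : CovariantDerivative (𝓡 n) (EuclideanSpace ℝ (Fin n))
      (fun x : M ↦ TangentSpace (𝓡 n) x), IsLeviCivita nabla ∧
    ∀ X Y : (x : M) → TangentSpace (𝓡 n) x, IsSmoothVectorField (𝓡 n) X → IsSmoothVectorField (𝓡 n) Y →
      ∀ x, covDerivEndo nabla S.phi X Y x
          + covDerivEndo nabla S.phi (S.phiField X) (S.phiField Y) x
        = S.eta x (Y x) • nabla S.xi x (S.phi x (X x))

end AlmostContactMetricStructure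

end AlmostContact

section Family

variable {M : Type*} [TopologicalSpace M] [ChartedSpace (EuclideanSpace ℝ (Fin 5)) M]
  [IsManifold (𝓡 5) ∞ M] [RiemannianBundle (fun x : M ↦ TangentSpace (𝓡 5) x)]
  [IsContMDiffRiemannianBundle (𝓡 5) ∞ (EuclideanSpace ℝ (Fin 5))
    (fun x : M ↦ TangentSpace (𝓡 5) x)]

/-- The one-forms `θ 0, …, θ 4` (written `e₁, …, e₅`) are an adapted coframe: they are
orthonormal, i.e. `g = ∑ θ_i ⊗ θ_i`, with `Φ = e₁ ∧ e₂ + e₃ ∧ e₄` and `η = e₅`. -/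
structure AlmostContactMetricStructure.IsAdaptedCoframe (S : AlmostContactMetricStructure 5 M)
    (θ : Fin 5 → (x : M) → TangentSpace (𝓡 5) x →L[ℝ] ℝ) : Prop where
  inner_eq (x : M) (u v : TangentSpace (𝓡 5) x) : inner ℝ u v = ∑ i, θ i x u * θ i x v
  fundamentalForm_eq (x : M) (u v : TangentSpace (𝓡 5) x) :
    S.fundamentalForm x u v = wedge (θ 0 x) (θ 1 x) u v + wedge (θ 2 x) (θ 3 x) u v
  eta_eq (x : M) : S.eta x = θ 4 x

variable {N : Type*} [TopologicalSpace N] [ChartedSpace (EuclideanSpace ℝ (Fin 6)) N]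
  [IsManifold (𝓡 6) ∞ N]

/-- The structure equations for one-forms `e₁, …, e₅, A₂`, with
`e₁ = e 0, …, e₅ = e 4` and `A₂ = e 5`. -/
structure StructureEquations (a₁ a₂ a₃ a₄ : ℝ)
    (e : Fin 6 → (x : N) → TangentSpace (𝓡 6) x →L[ℝ] ℝ) : Prop where
  d_e₁ : IsExteriorDerivative (e 0) fun x u v ↦
    wedge (e 5 x) (e 1 x) u v - (2 * a₁ + a₃) * wedge (e 2 x) (e 4 x) u v
      - (2 * a₂ + a₄) * wedge (e 3 x) (e 4 x) u v
  d_e₂ : IsExteriorDerivative (e 1) fun x u v ↦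
    -wedge (e 5 x) (e 0 x) u v + (2 * a₁ + a₃) * wedge (e 3 x) (e 4 x) u v
      - (2 * a₂ + a₄) * wedge (e 2 x) (e 4 x) u v
  d_e₃ : IsExteriorDerivative (e 2) fun x u v ↦
    -wedge (e 5 x) (e 3 x) u v + (2 * a₁ + a₃) * wedge (e 0 x) (e 4 x) u v
      + (2 * a₂ + a₄) * wedge (e 1 x) (e 4 x) u v
  d_e₄ : IsExteriorDerivative (e 3) fun x u v ↦
    wedge (e 5 x) (e 2 x) u v - (2 * a₁ + a₃) * wedge (e 1 x) (e 4 x) u v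
      + (2 * a₂ + a₄) * wedge (e 0 x) (e 4 x) u v
  d_e₅ : IsExteriorDerivative (e 4) fun x u v ↦
    -2 * (a₁ - a₃) * (wedge (e 0 x) (e 2 x) u v - wedge (e 1 x) (e 3 x) u v)
      - 2 * (a₂ - a₄) * (wedge (e 0 x) (e 3 x) u v + wedge (e 1 x) (e 2 x) u v)
  d_A₂ : IsExteriorDerivative (e 5) fun x u v ↦
    -2 * ((a₁ - a₃) * (2 * a₁ + a₃) + (a₂ - a₄) * (2 * a₂ + a₄))
      * (wedge (e 0 x) (e 1 x) u v - wedge (e 2 x) (e 3 x) u v)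

/-- The restriction (pullback) of a one-form on `N` along `ι : M → N`. -/
def pullbackOneForm (ι : M → N) (w : (y : N) → TangentSpace (𝓡 6) y →L[ℝ] ℝ) (x : M) :
    TangentSpace (𝓡 5) x →L[ℝ] ℝ :=
  (w (ι x)).comp (mfderiv (𝓡 5) (𝓡 6) ι x)

end Family

end

/-! Restricting `e₁, …, e₅` to `M` gives an orthonormal coframe `θ`, whose dual frame `X` is smooth.
Since `d` commutes with pullback and the functions `θ_k(X_j)` are constant, `g([X_i, X_j], X_k) =
-dθ_k(X_i, X_j)` is read off from the structure equations. The Koszul formula then gives all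
components of the Levi-Civita connection. As `φ` permutes the frame up to signs and kills `ξ = X 4`,
the components of `∇φ` are linear combinations of Koszul coefficients, and both conditions become
finitely many linear equations.

The restriction of `A₂` is an unknown one-form on `M`, but it does not matter: it enters as an
infinitesimal rotation of the planes `e₁e₂` and `e₃e₄` in opposite senses, which commutes with `φ`
and fixes `ξ`, so it contributes nothing to `∇φ` or `∇ξ`. With `p = 2a₁ + a₃`, `q = 2a₂ + a₄`, `r =
a₁ - a₃`, `s = a₂ - a₄`, what is left is `2p = 3r`, `2q = 3s` in the nearly cosymplectic case and `p
= r`, `q = s` in the quasi-cosymplectic case.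

The main lemmas are `IsExteriorDerivative.pullback`, existence and uniqueness of the connection
(`isLeviCivita_connection`, `inner_nabla`), the frame criteria `isNearlyCosymplectic_iff` and
`isQuasiCosymplectic_iff`, and the component computations `nablaPhiCoeff_symm_eq_zero_iff` and
`nablaPhiCoeff_quasi_iff`. -/

noncomputable section

/-! ### One-forms, vector fields and the exterior derivative in a chart -/

section CoordinateForm

open Set Filter
open scoped Topology

variable {E : Type*} [NormedAddCommGroup E] [NormedSpace ℝ E]
  {H : Type*} [TopologicalSpace H] {I : ModelWithCorners ℝ E H}
  [CompleteSpace E] {M : Type*} [TopologicalSpace M] [ChartedSpace H M]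
  {E' : Type*} [NormedAddCommGroup E'] [NormedSpace ℝ E']
  {H' : Type*} [TopologicalSpace H'] {I' : ModelWithCorners ℝ E' H'}
  {N : Type*} [TopologicalSpace N] [ChartedSpace H' N]

/-- The expression of a one-form in the preferred chart at `x₀`. -/
def coordForm (w : (x : M) → TangentSpace I x →L[ℝ] ℝ) (x₀ : M) (z : E) : E →L[ℝ] ℝ :=
  (w ((extChartAt I x₀).symm z)).comp
    (mfderivWithin 𝓘(ℝ, E) I (extChartAt I x₀).symm (range I) z)

theorem coordForm_mfderiv_extChartAt [IsManifold I 1 M]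
    (w : (x : M) → TangentSpace I x →L[ℝ] ℝ) (x₀ : M) {x : M}
    (hx : x ∈ (extChartAt I x₀).source) (v : TangentSpace I x) :
    coordForm w x₀ (extChartAt I x₀ x) (mfderiv I 𝓘(ℝ, E) (extChartAt I x₀) x v) = w x v := by
  -- The point `y` occurs in the type of `w y`, so it cannot be rewritten directly; all tangent
  -- spaces are `E` by definition, which lets the values be compared there.
  have key : ∀ y, y = x → ∀ u : E, (w y : E →L[ℝ] ℝ) u = (w x : E →L[ℝ] ℝ) u := by
    rintro y rfl u
    rfl
  have h := congr($(mfderivWithin_extChartAt_symm_comp_mfderiv_extChartAt' (I := I) hx) v)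
  have h2 := key _ ((extChartAt I x₀).left_inv hx) v
  refine Eq.trans ?_ h2
  exact congrArg (w _ : E →L[ℝ] ℝ) h


theorem IsSmoothOneForm.contDiffAt_coordForm [I.Boundaryless] [IsManifold I ∞ M]
    {w : (x : M) → TangentSpace I x →L[ℝ] ℝ} (hw : IsSmoothOneForm I w) (x₀ : M) :
    ContDiffAt ℝ ∞ (coordForm w x₀) (extChartAt I x₀ x₀) := by
  have h := (contMDiffAt_iff.1 ((contMDiffAt_hom_bundle _).1 (hw x₀)).2).2
  rw [I.range_eq_univ, contDiffWithinAt_univ] at h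
  refine h.congr_of_eventuallyEq ?_
  filter_upwards [extChartAt_target_mem_nhds (I := I) x₀] with z hz
  have hs : (extChartAt I x₀).symm z ∈ (chartAt H x₀).source := by
    rw [← extChartAt_source I]
    exact (extChartAt I x₀).map_target hz
  have h1 := TangentBundle.symmL_trivializationAt (I := I) hs
  have h2 : (trivializationAt ℝ (Trivial M ℝ) x₀).continuousLinearMapAt ℝ
      ((extChartAt I x₀).symm z) = ContinuousLinearMap.id ℝ ℝ :=
    Trivial.continuousLinearMapAt_trivialization ..
  have h3 : mfderivWithin 𝓘(ℝ, E) I (extChartAt I x₀).symm (range I) z =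
      (trivializationAt E (TangentSpace I) x₀).symmL ℝ ((extChartAt I x₀).symm z) := by
    rw [h1, (extChartAt I x₀).right_inv hz]
  ext v
  refine Eq.trans ?_ congr($h2 ((w ((extChartAt I x₀).symm z))
    ((trivializationAt E (TangentSpace I) x₀).symmL ℝ ((extChartAt I x₀).symm z) v))).symm
  exact congr((w ((extChartAt I x₀).symm z) : E →L[ℝ] ℝ) ($h3 v))

theorem mvfderiv_eq_fderiv_of_eventuallyEq [I.Boundaryless] [IsManifold I 1 M] {f : M → ℝ}
    {g : E → ℝ} {x₀ : M} (hg : DifferentiableAt ℝ g (extChartAt I x₀ x₀))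
    (hfg : f =ᶠ[𝓝 x₀] g ∘ extChartAt I x₀) (v : TangentSpace I x₀) :
    mvfderiv I f x₀ v = fderiv ℝ g (extChartAt I x₀ x₀) v := by
  have h1 : HasMFDerivAt I 𝓘(ℝ, ℝ) (g ∘ extChartAt I x₀) x₀ _ :=
    HasMFDerivAt.comp x₀ hg.hasFDerivAt.hasMFDerivAt
      (mdifferentiableAt_extChartAt (I := I) (mem_chart_source H x₀)).hasMFDerivAt
  have h2 := (h1.congr_of_eventuallyEq hfg).mfderiv
  rw [mvfderiv, h2, mfderiv_extChartAt_self]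
  rfl


/-- The expression of a vector field in the preferred chart at `x₀`. -/
def coordField (Y : (x : M) → TangentSpace I x) (x₀ : M) (z : E) : E :=
  VectorField.mpullbackWithin 𝓘(ℝ, E) I (extChartAt I x₀).symm Y (range I) z

theorem differentiableAt_coordField [I.Boundaryless] [IsManifold I ∞ M] {x₀ : M}
    {Y : (x : M) → TangentSpace I x} (hY : MDiffAt (T% Y) x₀) :
    DifferentiableAt ℝ (coordField Y x₀) (extChartAt I x₀ x₀) := by
  rw [← mdifferentiableWithinAt_univ] at hY
  have h := hY.differentiableWithinAt_mpullbackWithin_vectorField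
  have h' : DifferentiableWithinAt ℝ (coordField Y x₀)
    ((extChartAt I x₀).symm ⁻¹' univ ∩ range I) (extChartAt I x₀ x₀) := h
  rwa [I.range_eq_univ, preimage_univ, inter_univ, differentiableWithinAt_univ] at h'

theorem coordField_self [IsManifold I 1 M] {x₀ : M}
    (Y : (x : M) → TangentSpace I x) :
    coordField Y x₀ (extChartAt I x₀ x₀) = (Y x₀ : E) := by
  have key : ∀ y, y = x₀ → (Y y : E) = (Y x₀ : E) := by
    rintro y rfl
    rfl
  rw [coordField, VectorField.mpullbackWithin_apply]
  refine Eq.trans (mfderivWithin_extChartAt_symm_inverse_apply (I := I) (x := x₀) _) ?_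
  exact key _ (extChartAt_to_inv x₀)

theorem mlieBracket_eq_coordField [I.Boundaryless] [IsManifold I 1 M] {x₀ : M}
    (X Y : (x : M) → TangentSpace I x) :
    (VectorField.mlieBracket I X Y x₀ : E) =
      fderiv ℝ (coordField Y x₀) (extChartAt I x₀ x₀) (X x₀ : E)
      - fderiv ℝ (coordField X x₀) (extChartAt I x₀ x₀) (Y x₀ : E) := by
  have h : (VectorField.mlieBracket I X Y x₀ : E) =
      (ContinuousLinearMap.id ℝ E).inverse (VectorField.lieBracketWithin ℝ (coordField X x₀)
        (coordField Y x₀) ((extChartAt I x₀).symm ⁻¹' univ ∩ range I) (extChartAt I x₀ x₀)) := by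
    rw [← VectorField.mlieBracketWithin_univ, VectorField.mlieBracketWithin_apply,
      mfderiv_extChartAt_self]
    rfl
  rw [h, ContinuousLinearMap.inverse_id, ContinuousLinearMap.id_apply, I.range_eq_univ,
    preimage_univ, inter_univ, VectorField.lieBracketWithin_univ, VectorField.lieBracket,
    coordField_self, coordField_self]

theorem coordForm_self [IsManifold I 1 M] {x₀ : M}
    (w : (x : M) → TangentSpace I x →L[ℝ] ℝ) :
    coordForm w x₀ (extChartAt I x₀ x₀) = (w x₀ : E →L[ℝ] ℝ) := by
  ext v
  have h := coordForm_mfderiv_extChartAt w x₀ (mem_extChartAt_source (I := I) x₀) v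
  rw [mfderiv_extChartAt_self] at h
  exact h

theorem coordForm_coordField [IsManifold I 1 M]
    (w : (x : M) → TangentSpace I x →L[ℝ] ℝ) (Y : (x : M) → TangentSpace I x) (x₀ : M) {x : M}
    (hx : x ∈ (extChartAt I x₀).source) :
    coordForm w x₀ (extChartAt I x₀ x) (coordField Y x₀ (extChartAt I x₀ x)) = w x (Y x) := by
  have key : ∀ y, y = x → w y (Y y) = w x (Y x) := by
    rintro y rfl
    rfl
  have h := isInvertible_mfderivWithin_extChartAt_symm (I := I)
    ((extChartAt I x₀).map_source hx)
  rw [← key _ ((extChartAt I x₀).left_inv hx)]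
  exact congrArg (w _ : E →L[ℝ] ℝ) (h.self_apply_inverse _)

theorem mvfderiv_apply_vectorField [I.Boundaryless] [IsManifold I ∞ M]
    {w : (x : M) → TangentSpace I x →L[ℝ] ℝ} {x₀ : M}
    (hw : DifferentiableAt ℝ (coordForm w x₀) (extChartAt I x₀ x₀))
    {Y : (x : M) → TangentSpace I x} (hY : MDiffAt (T% Y) x₀) (v : TangentSpace I x₀) :
    mvfderiv I (fun y ↦ w y (Y y)) x₀ v =
      fderiv ℝ (coordForm w x₀) (extChartAt I x₀ x₀) (v : E) (Y x₀ : E) +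
      (w x₀ : E →L[ℝ] ℝ) (fderiv ℝ (coordField Y x₀) (extChartAt I x₀ x₀) (v : E)) := by
  have hY' := differentiableAt_coordField hY
  rw [mvfderiv_eq_fderiv_of_eventuallyEq (hw.clm_apply hY'), fderiv_clm_apply hw hY',
    coordForm_self, coordField_self]
  · exact add_comm _ _
  · filter_upwards [extChartAt_source_mem_nhds (I := I) x₀] with x hx
    exact (coordForm_coordField w Y x₀ hx).symm

/-- By the product rule, the derivatives of the components of `X` and `Y` occur in the first two
terms exactly as in the bracket, and they cancel. The result depends only on the values of `X` and
`Y` at `x₀`. -/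
theorem exteriorDerivative_eq_fderiv_coordForm [I.Boundaryless] [IsManifold I ∞ M]
    {w : (x : M) → TangentSpace I x →L[ℝ] ℝ} {x₀ : M}
    (hw : DifferentiableAt ℝ (coordForm w x₀) (extChartAt I x₀ x₀))
    {X Y : (x : M) → TangentSpace I x} (hX : MDiffAt (T% X) x₀) (hY : MDiffAt (T% Y) x₀) :
    mvfderiv I (fun y ↦ w y (Y y)) x₀ (X x₀) - mvfderiv I (fun y ↦ w y (X y)) x₀ (Y x₀)
      - w x₀ (VectorField.mlieBracket I X Y x₀) =
    fderiv ℝ (coordForm w x₀) (extChartAt I x₀ x₀) (X x₀ : E) (Y x₀ : E)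
    - fderiv ℝ (coordForm w x₀) (extChartAt I x₀ x₀) (Y x₀ : E) (X x₀ : E) := by
  have h := congrArg (w x₀ : E →L[ℝ] ℝ) (mlieBracket_eq_coordField (x₀ := x₀) X Y)
  have h' : w x₀ (VectorField.mlieBracket I X Y x₀) = _ :=
    h.trans (ContinuousLinearMap.map_sub (w x₀ : E →L[ℝ] ℝ) _ _)
  rw [mvfderiv_apply_vectorField hw hX, mvfderiv_apply_vectorField hw hY, h']
  ring

end CoordinateForm

/-! ### The exterior derivative commutes with pullback -/

section Pullback

open Set Filter
open scoped Topology

variable {E : Type*} [NormedAddCommGroup E] [NormedSpace ℝ E]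
  {H : Type*} [TopologicalSpace H] {I : ModelWithCorners ℝ E H} [I.Boundaryless] [CompleteSpace E]
  {M : Type*} [TopologicalSpace M] [ChartedSpace H M] [IsManifold I ∞ M]
  {E' : Type*} [NormedAddCommGroup E'] [NormedSpace ℝ E']
  {H' : Type*} [TopologicalSpace H'] {I' : ModelWithCorners ℝ E' H'} [I'.Boundaryless] [CompleteSpace E']
  {N : Type*} [TopologicalSpace N] [ChartedSpace H' N] [IsManifold I' ∞ N]

theorem ContMDiff.contDiffAt_writtenInExtChartAt {ι : M → N} (hι : ContMDiff I I' ∞ ι) (x₀ : M) :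
    ContDiffAt ℝ ∞ (writtenInExtChartAt I I' x₀ ι) (extChartAt I x₀ x₀) := by
  have h := (contMDiffAt_iff.1 (hι x₀)).2
  rwa [I.range_eq_univ, contDiffWithinAt_univ] at h

omit [I'.Boundaryless] in
theorem coordForm_pullback_eventuallyEq {ι : M → N} (hι : ContMDiff I I' ∞ ι)
    (w : (y : N) → TangentSpace I' y →L[ℝ] ℝ) (x₀ : M) :
    coordForm (fun x ↦ (w (ι x)).comp (mfderiv I I' ι x)) x₀ =ᶠ[𝓝 (extChartAt I x₀ x₀)]
      fun z ↦ (coordForm w (ι x₀) (writtenInExtChartAt I I' x₀ ι z)).comp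
        (fderiv ℝ (writtenInExtChartAt I I' x₀ ι) z) := by
  have hc : ∀ᶠ z in 𝓝 (extChartAt I x₀ x₀),
      ι ((extChartAt I x₀).symm z) ∈ (extChartAt I' (ι x₀)).source := by
    have h1 : ContinuousAt (ι ∘ (extChartAt I x₀).symm) (extChartAt I x₀ x₀) :=
      ContinuousAt.comp (by exact hι.continuous.continuousAt) (continuousAt_extChartAt_symm x₀)
    refine h1.preimage_mem_nhds ?_
    rw [Function.comp_apply, extChartAt_to_inv]
    exact extChartAt_source_mem_nhds _
  filter_upwards [hc, extChartAt_target_mem_nhds (I := I) x₀] with z hz hzt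
  have d1 : HasMFDerivAt 𝓘(ℝ, E) I (extChartAt I x₀).symm z
      (mfderivWithin 𝓘(ℝ, E) I (extChartAt I x₀).symm (range I) z) := by
    have := (mdifferentiableWithinAt_extChartAt_symm hzt).hasMFDerivWithinAt
    rw [I.range_eq_univ] at this ⊢
    exact hasMFDerivWithinAt_univ.1 this
  have d2 := (hι.mdifferentiableAt (x := (extChartAt I x₀).symm z) (by simp)).hasMFDerivAt
  have d3 := (mdifferentiableAt_extChartAt (I := I') (x := ι x₀)
    (by rwa [← extChartAt_source I'])).hasMFDerivAt
  have d : HasMFDerivAt 𝓘(ℝ, E) 𝓘(ℝ, E') (writtenInExtChartAt I I' x₀ ι) z _ :=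
    HasMFDerivAt.comp z d3 (HasMFDerivAt.comp z d2 d1)
  ext v
  have h := coordForm_mfderiv_extChartAt w (ι x₀) hz
    (mfderiv I I' ι ((extChartAt I x₀).symm z) 
      (mfderivWithin 𝓘(ℝ, E) I (extChartAt I x₀).symm (range I) z v))
  refine h.symm.trans ?_
  refine congrArg (coordForm w (ι x₀) (writtenInExtChartAt I I' x₀ ι z))
    ?_
  rw [← mfderiv_eq_fderiv, d.mfderiv]
  rfl

theorem IsSmoothOneForm.contDiffAt_coordForm_pullback {ι : M → N} (hι : ContMDiff I I' ∞ ι)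
    {w : (y : N) → TangentSpace I' y →L[ℝ] ℝ} (hw : IsSmoothOneForm I' w) (x₀ : M) :
    ContDiffAt ℝ ∞ (coordForm (fun x ↦ (w (ι x)).comp (mfderiv I I' ι x)) x₀)
      (extChartAt I x₀ x₀) := by
  refine ContDiffAt.congr_of_eventuallyEq ?_ (coordForm_pullback_eventuallyEq hι w x₀)
  have hf := hι.contDiffAt_writtenInExtChartAt x₀
  have h0 : writtenInExtChartAt I I' x₀ ι (extChartAt I x₀ x₀) = extChartAt I' (ι x₀) (ι x₀) := by
    simp [writtenInExtChartAt]
  have hW := hw.contDiffAt_coordForm (ι x₀)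
  rw [← h0] at hW
  exact ContDiffAt.clm_comp (hW.comp (extChartAt I x₀ x₀) hf) (hf.fderiv_right (by simp))

-- Differentiating `W(f) ∘ Df` also produces the term `W(f)(D²f(u, v))`; the second derivative is
-- symmetric, so antisymmetrizing removes it.
omit [CompleteSpace E] [CompleteSpace E'] in
theorem fderiv_comp_fderiv_sub_swap {f : E → E'} {W : E' → E' →L[ℝ] ℝ} {z : E}
    (hf : ContDiffAt ℝ ∞ f z) (hW : DifferentiableAt ℝ W (f z)) (u v : E) :
    fderiv ℝ (fun z ↦ (W (f z)).comp (fderiv ℝ f z)) z u v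
      - fderiv ℝ (fun z ↦ (W (f z)).comp (fderiv ℝ f z)) z v u =
    fderiv ℝ W (f z) (fderiv ℝ f z u) (fderiv ℝ f z v)
      - fderiv ℝ W (f z) (fderiv ℝ f z v) (fderiv ℝ f z u) := by
  have hsymm : IsSymmSndFDerivAt ℝ f z := hf.isSymmSndFDerivAt
    (by rw [minSmoothness_of_isRCLikeNormedField]; exact WithTop.coe_le_coe.2 (le_top : (2 : ℕ∞) ≤ ⊤))
  have hf2 : DifferentiableAt ℝ (fderiv ℝ f) z :=
    (hf.fderiv_right (m := ∞) (by simp)).differentiableAt (by simp)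
  have hD := (hW.hasFDerivAt.comp z (hf.differentiableAt (by simp)).hasFDerivAt).clm_comp
    hf2.hasFDerivAt
  have hD' : fderiv ℝ (fun z ↦ (W (f z)).comp (fderiv ℝ f z)) z = _ := hD.fderiv
  rw [hD']
  simp [hsymm u v]

theorem IsExteriorDerivative.pullback [FiniteDimensional ℝ E'] {ι : M → N} (hι : ContMDiff I I' ∞ ι)
    {w : (y : N) → TangentSpace I' y →L[ℝ] ℝ} (hw : IsSmoothOneForm I' w)
    {B : (y : N) → TangentSpace I' y → TangentSpace I' y → ℝ} (h : IsExteriorDerivative w B) :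
    IsExteriorDerivative (fun x ↦ (w (ι x)).comp (mfderiv I I' ι x))
      (fun x u v ↦ B (ι x) (mfderiv I I' ι x u) (mfderiv I I' ι x v)) := by
  intro x₀ X Y hX hY
  have hf := hι.contDiffAt_writtenInExtChartAt x₀
  have h0 : writtenInExtChartAt I I' x₀ ι (extChartAt I x₀ x₀) = extChartAt I' (ι x₀) (ι x₀) := by
    simp [writtenInExtChartAt]
  have hW := (hw.contDiffAt_coordForm (ι x₀)).differentiableAt (by simp)
  rw [exteriorDerivative_eq_fderiv_coordForm
    ((hw.contDiffAt_coordForm_pullback hι x₀).differentiableAt (by simp)) hX hY]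
  -- The hypothesis on `dw` is tested on vector fields of `N`, so the image vectors at `ι x₀` are
  -- extended to fields; the choice is harmless because only their values at `ι x₀` count.
  have hext (v : TangentSpace I' (ι x₀)) : MDiffAt (T% (FiberBundle.extend E' v)) (ι x₀) :=
    FiberBundle.mdifferentiableAt_extend ..
  have hN := h (ι x₀) _ _ (hext (mfderiv I I' ι x₀ (X x₀))) (hext (mfderiv I I' ι x₀ (Y x₀)))
  rw [exteriorDerivative_eq_fderiv_coordForm hW (hext _) (hext _)] at hN
  simp only [FiberBundle.extend_apply_self] at hN
  refine Eq.trans ?_ hN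
  have hm : mfderiv I I' ι x₀ = fderiv ℝ (writtenInExtChartAt I I' x₀ ι) (extChartAt I x₀ x₀) := by
    rw [(hι.mdifferentiableAt (by simp)).mfderiv, I.range_eq_univ, fderivWithin_univ]
  rw [(coordForm_pullback_eventuallyEq hι w x₀).fderiv_eq, hm]
  rw [← h0] at hW ⊢
  exact fderiv_comp_fderiv_sub_swap hf hW _ _

end Pullback

/-! ### Smoothness of the dual frame -/

section DualFrame

open Set Filter
open scoped Topology

variable {κ : Type*} {E : Type*} [NormedAddCommGroup E] [NormedSpace ℝ E] [CompleteSpace E]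
  {H : Type*} [TopologicalSpace H] {I : ModelWithCorners ℝ E H} [I.Boundaryless]
  {M : Type*} [TopologicalSpace M] [ChartedSpace H M] [IsManifold I ∞ M]

omit [I.Boundaryless] [CompleteSpace E] in
theorem isInvertible_pi_coordForm {θ : κ → (x : M) → TangentSpace I x →L[ℝ] ℝ}
    (hinv : ∀ x, (ContinuousLinearMap.pi fun i ↦ θ i x).IsInvertible) (x₀ : M) {z : E}
    (hz : z ∈ (extChartAt I x₀).target) :
    (ContinuousLinearMap.pi fun i ↦ coordForm (θ i) x₀ z).IsInvertible := by
  exact (hinv _).comp (isInvertible_mfderivWithin_extChartAt_symm hz)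

/-- In a chart the field is the inverse of the coframe operator applied to the constant vector `c`,
and inversion is smooth at invertible operators. -/
theorem isSmoothVectorField_of_isInvertible [Fintype κ] {θ : κ → (x : M) → TangentSpace I x →L[ℝ] ℝ}
    (hθ : ∀ i x₀, ContDiffAt ℝ ∞ (coordForm (θ i) x₀) (extChartAt I x₀ x₀))
    (hinv : ∀ x, (ContinuousLinearMap.pi fun i ↦ θ i x).IsInvertible)
    {X : (x : M) → TangentSpace I x} {c : κ → ℝ} (hX : ∀ i x, θ i x (X x) = c i) :
    IsSmoothVectorField I X := by
  classical
  intro x₀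
  rw [contMDiffAt_section]
  have h1 : ContDiffAt ℝ ∞ (fun z ↦ (ContinuousLinearMap.pi fun i ↦ coordForm (θ i) x₀ z).inverse c)
      (extChartAt I x₀ x₀) := by
    have hpi : ContDiffAt ℝ ∞ (fun z ↦ ContinuousLinearMap.pi fun i ↦ coordForm (θ i) x₀ z)
        (extChartAt I x₀ x₀) := by
      have hsum : (fun z ↦ ContinuousLinearMap.pi fun i ↦ coordForm (θ i) x₀ z) = fun z ↦
          ∑ i, (ContinuousLinearMap.single ℝ (fun _ : κ ↦ ℝ) i).comp (coordForm (θ i) x₀ z) := by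
        ext z v i
        simp [Pi.single_apply]
      rw [hsum]
      exact ContDiffAt.sum fun i _ ↦ contDiffAt_const.clm_comp (hθ i x₀)
    have := (isInvertible_pi_coordForm hinv x₀ (mem_extChartAt_target x₀)).contDiffAt_map_inverse
      (n := ∞)
    exact (this.comp (extChartAt I x₀ x₀) hpi).clm_apply contDiffAt_const
  refine (h1.contMDiffAt.comp x₀ (contMDiffAt_extChartAt (I := I))).congr_of_eventuallyEq ?_
  filter_upwards [extChartAt_source_mem_nhds (I := I) x₀] with x hx
  have hx' : x ∈ (chartAt H x₀).source := by rwa [← extChartAt_source I]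
  have h2 := TangentBundle.continuousLinearMapAt_trivializationAt (I := I) hx'
  have h3 := congr($h2 (X x))
  rw [Trivialization.continuousLinearMapAt_apply_of_mem] at h3
  swap
  · simpa using hx'
  refine h3.trans ?_
  symm
  refine (isInvertible_pi_coordForm hinv x₀
    ((extChartAt I x₀).map_source hx)).inverse_apply_eq.2 ?_
  ext i
  exact ((coordForm_mfderiv_extChartAt (θ i) x₀ hx (X x)).trans (hX i x)).symm

theorem exists_smooth_dualFrame [Fintype κ] [DecidableEq κ] {θ : κ → (x : M) → TangentSpace I x →L[ℝ] ℝ}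
    (hθ : ∀ i x₀, ContDiffAt ℝ ∞ (coordForm (θ i) x₀) (extChartAt I x₀ x₀))
    (hinv : ∀ x, (ContinuousLinearMap.pi fun i ↦ θ i x).IsInvertible) :
    ∃ X : κ → (x : M) → TangentSpace I x, (∀ j, IsSmoothVectorField I (X j)) ∧
      ∀ i j x, θ i x (X j x) = if i = j then 1 else 0 := by
  refine ⟨fun j x ↦ (ContinuousLinearMap.pi fun i ↦ θ i x).inverse (Pi.single j 1), ?_⟩
  have h : ∀ i j x, θ i x ((ContinuousLinearMap.pi fun i ↦ θ i x).inverse (Pi.single j 1)) 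
      = if i = j then 1 else 0 := by
    intro i j x
    have := congrFun ((hinv x).self_apply_inverse (Pi.single j 1)) i
    simpa [Pi.single_apply] using this
  exact ⟨fun j ↦ isSmoothVectorField_of_isInvertible hθ hinv fun i x ↦ h i j x, h⟩

end DualFrame

theorem ContinuousLinearMap.eq_zero_of_forall_exists_sum {V W κ : Type*} [Fintype κ]
    [AddCommGroup V] [Module ℝ V] [TopologicalSpace V] {_ : AddCommMonoid W} {_ : Module ℝ W}
    {_ : TopologicalSpace W} {e : κ → V} (he : ∀ u, ∃ a : κ → ℝ, u = ∑ i, a i • e i)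
    {T : V →L[ℝ] W} (h : ∀ i, T (e i) = 0) : T = 0 := by
  ext u
  obtain ⟨a, rfl⟩ := he u
  simp [map_sum, h]

theorem eq_zero_of_forall_exists_sum₃ {V κ : Type*} [Fintype κ]
    [AddCommGroup V] [Module ℝ V] [TopologicalSpace V] [IsTopologicalAddGroup V]
    [ContinuousSMul ℝ V] {e : κ → V} (he : ∀ u, ∃ a : κ → ℝ, u = ∑ i, a i • e i)
    {T : V →L[ℝ] V →L[ℝ] V →L[ℝ] ℝ} (h : ∀ i j k, T (e i) (e j) (e k) = 0) : T = 0 := by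
  have h2 (i j : κ) : T (e i) (e j) = 0 :=
    ContinuousLinearMap.eq_zero_of_forall_exists_sum he (h i j)
  have h1 (i : κ) : T (e i) = 0 :=
    ContinuousLinearMap.eq_zero_of_forall_exists_sum (T := T (e i)) he (h2 i)
  exact ContinuousLinearMap.eq_zero_of_forall_exists_sum (T := T) he h1

/-! ### The Levi-Civita connection in a global orthonormal frame -/

section OrthonormalFrame

variable {n : ℕ} {M : Type*} [TopologicalSpace M] [ChartedSpace (EuclideanSpace ℝ (Fin n)) M]
  [IsManifold (𝓡 n) ∞ M] [RiemannianBundle (fun x : M ↦ TangentSpace (𝓡 n) x)]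
  {κ : Type*} [Fintype κ] [DecidableEq κ]

/-- The vector fields `X i` form a smooth global orthonormal frame. -/
structure IsSmoothOrthonormalFrame (X : κ → (x : M) → TangentSpace (𝓡 n) x) : Prop where
  smooth (i : κ) : IsSmoothVectorField (𝓡 n) (X i)
  inner_eq (i j : κ) (x : M) : inner ℝ (X i x) (X j x) = if i = j then 1 else 0
  sum_inner_smul (x : M) (u : TangentSpace (𝓡 n) x) : ∑ i, inner ℝ (X i x) u • X i x = u

/-- The structure functions `g([X i, X j], X k)` of a frame. -/
def structureFunction (X : κ → (x : M) → TangentSpace (𝓡 n) x) (i j k : κ) (x : M) : ℝ :=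
  inner ℝ (VectorField.mlieBracket (𝓡 n) (X i) (X j) x) (X k x)

/-- The Koszul formula for `g(∇_{X i} (X j), X k)` in an orthonormal frame. -/
def koszul (X : κ → (x : M) → TangentSpace (𝓡 n) x) (i j k : κ) (x : M) : ℝ :=
  (structureFunction X i j k x - structureFunction X j k i x + structureFunction X k i j x) / 2

namespace IsSmoothOrthonormalFrame

variable {X : κ → (x : M) → TangentSpace (𝓡 n) x} (hX : IsSmoothOrthonormalFrame X)
include hX

theorem mdifferentiableAt (i : κ) (x : M) :
    MDifferentiableAt (𝓡 n) (𝓡 n).tangent (fun y ↦ (⟨y, X i y⟩ : TangentBundle (𝓡 n) M)) x :=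
  (hX.smooth i).mdifferentiableAt (by simp)

theorem ext_inner {x : M} {u v : TangentSpace (𝓡 n) x}
    (h : ∀ k, inner ℝ (X k x) u = inner ℝ (X k x) v) : u = v := by
  rw [← hX.sum_inner_smul x u, ← hX.sum_inner_smul x v]
  simp only [h]

variable [IsContMDiffRiemannianBundle (𝓡 n) ∞ (EuclideanSpace ℝ (Fin n))
    (fun x : M ↦ TangentSpace (𝓡 n) x)]

theorem mdifferentiableAt_inner {Y : (x : M) → TangentSpace (𝓡 n) x} {x : M}
    (hY : MDifferentiableAt (𝓡 n) (𝓡 n).tangent (fun y ↦ (⟨y, Y y⟩ : TangentBundle (𝓡 n) M)) x)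
    (k : κ) : MDifferentiableAt (𝓡 n) 𝓘(ℝ, ℝ) (fun y ↦ inner ℝ (X k y) (Y y)) x :=
  haveI : IsContMDiffRiemannianBundle (𝓡 n) 1 (EuclideanSpace ℝ (Fin n))
      (fun x : M ↦ TangentSpace (𝓡 n) x) := IsContMDiffRiemannianBundle.of_le (n := ∞) (by simp)
  (hX.mdifferentiableAt k x).inner_bundle hY

/-- This is the flat connection that makes the frame parallel. It serves as a base point: the
Levi-Civita connection differs from it by a tensor with Koszul coefficients. -/
theorem isCovariantDerivativeOn_flat :
    IsCovariantDerivativeOn (I := 𝓡 n) (EuclideanSpace ℝ (Fin n))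
      (V := fun x : M ↦ TangentSpace (𝓡 n) x) (fun Y x ↦
        ∑ k, (mvfderiv (𝓡 n) (fun y ↦ inner ℝ (X k y) (Y y)) x).smulRight (X k x)) where
  add {Y Y' x} hY hY' _ := by
    rw [← Finset.sum_add_distrib]
    refine Finset.sum_congr rfl fun k _ ↦ ?_
    simp only [Pi.add_apply, inner_add_right]
    rw [mvfderiv_fun_add (hX.mdifferentiableAt_inner hY k) (hX.mdifferentiableAt_inner hY' k)]
    ext v
    simp [add_smul]
  leibniz {Y g x} hY hg _ := by
    have h (k : κ) : mvfderiv (𝓡 n) (fun y ↦ inner ℝ (X k y) ((g • Y) y)) x =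
        g x • mvfderiv (𝓡 n) (fun y ↦ inner ℝ (X k y) (Y y)) x
          + inner ℝ (X k x) (Y x) • mvfderiv (𝓡 n) g x := by
      have h1 : (fun y ↦ inner ℝ (X k y) ((g • Y) y)) = fun y ↦ g y * inner ℝ (X k y) (Y y) := by
        ext y
        simp [inner_smul_right]
      rw [h1, mvfderiv_fun_mul hg (hX.mdifferentiableAt_inner hY k)]
    simp only [h]
    ext v
    simp only [sum_apply, ContinuousLinearMap.smulRight_apply,
      add_apply, smul_apply, add_smul,
      Finset.sum_add_distrib, Finset.smul_sum]
    congr 1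
    · simp [mul_smul]
    · conv_rhs => rw [← hX.sum_inner_smul x (Y x)]
      simp [Finset.smul_sum, smul_smul, mul_comm]

/-- The Levi-Civita connection in terms of a global orthonormal frame. -/
def connection : CovariantDerivative (𝓡 n) (EuclideanSpace ℝ (Fin n))
    (fun x : M ↦ TangentSpace (𝓡 n) x) where
  toFun Y x := ∑ k, (mvfderiv (𝓡 n) (fun y ↦ inner ℝ (X k y) (Y y)) x).smulRight (X k x) +
    (∑ i, ∑ j, ∑ k, koszul X i j k x • 
      (innerSL ℝ (X j x)).smulRight ((innerSL ℝ (X i x)).smulRight (X k x))) (Y x)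
  isCovariantDerivativeOnUniv := hX.isCovariantDerivativeOn_flat.add_one_form 
    (A := fun x ↦ (∑ i, ∑ j, ∑ k, koszul X i j k x • 
      (innerSL ℝ (X j x)).smulRight ((innerSL ℝ (X i x)).smulRight (X k x))))

theorem mvfderiv_inner (j k : κ) (x : M) :
    mvfderiv (𝓡 n) (fun y ↦ inner ℝ (X j y) (X k y)) x = 0 := by
  simp only [hX.inner_eq]
  exact mvfderiv_const _

theorem connection_apply (i j : κ) (x : M) :
    hX.connection (X j) x (X i x) = ∑ k, koszul X i j k x • X k x := by
  simp only [connection, hX.mvfderiv_inner]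
  simp [hX.inner_eq, sum_apply]

theorem inner_connection (i j k : κ) (x : M) :
    inner ℝ (hX.connection (X j) x (X i x)) (X k x) = koszul X i j k x := by
  simp [hX.connection_apply, sum_inner, inner_smul_left, hX.inner_eq]

omit [Fintype κ] [DecidableEq κ] hX in
theorem structureFunction_swap (i j k : κ) (x : M) :
    structureFunction X i j k x = -structureFunction X j i k x := by
  rw [structureFunction, structureFunction, VectorField.mlieBracket_swap_apply, inner_neg_left]

theorem exists_eq_sum {x : M} (u : TangentSpace (𝓡 n) x) : ∃ a : κ → ℝ, u = ∑ i, a i • X i x :=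
  ⟨_, (hX.sum_inner_smul x u).symm⟩

/-- Both defects are tensors, so the frame suffices. Metric compatibility is the skewness of `koszul
X i j k` in `j, k`; zero torsion is the identity `koszul X i j k - koszul X j i k =
structureFunction X i j k`. -/
theorem isLeviCivita_connection : IsLeviCivita hX.connection := by
  have : IsContMDiffRiemannianBundle (𝓡 n) 1 (EuclideanSpace ℝ (Fin n))
    (fun x : M ↦ TangentSpace (𝓡 n) x) := IsContMDiffRiemannianBundle.of_le (n := ∞) (by simp)
  constructor
  · have h (x : M) (i j k : κ) : hX.connection.derivMetricTensor x (X i x) (X j x) (X k x) = 0 := by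
      rw [hX.connection.derivMetricTensor_apply x (hX.mdifferentiableAt i x)
        (hX.mdifferentiableAt j x), hX.mvfderiv_inner]
      have h1 := hX.inner_connection k i j x
      have h2 := hX.inner_connection k j i x
      rw [real_inner_comm] at h2
      have h3 : koszul X k i j x + koszul X k j i x = 0 := by
        simp only [koszul]
        linarith [structureFunction_swap (X := X) k i j x,
          structureFunction_swap (X := X) i j k x, structureFunction_swap (X := X) j k i x]
      change (0 : ℝ) - inner ℝ (hX.connection (X i) x (X k x)) (X j x)
        - inner ℝ (X i x) (hX.connection (X j) x (X k x)) = 0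
      rw [h1, h2]
      linarith
    exact funext fun x ↦ eq_zero_of_forall_exists_sum₃ hX.exists_eq_sum
      (T := hX.connection.derivMetricTensor x) (h x)
  · ext1 x
    refine ContinuousLinearMap.eq_zero_of_forall_exists_sum hX.exists_eq_sum fun i ↦
      ContinuousLinearMap.eq_zero_of_forall_exists_sum hX.exists_eq_sum fun j ↦ ?_
    rw [hX.connection.torsion_apply (hX.mdifferentiableAt i x) (hX.mdifferentiableAt j x)]
    refine hX.ext_inner fun k ↦ ?_
    have h3 : koszul X i j k x - koszul X j i k x - structureFunction X i j k x = 0 := by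
      simp only [koszul]
      linarith [structureFunction_swap (X := X) i j k x,
          structureFunction_swap (X := X) j k i x, structureFunction_swap (X := X) k i j x]
    rw [← hX.inner_connection, ← hX.inner_connection, structureFunction] at h3
    rw [inner_zero_right, real_inner_comm, inner_sub_left, inner_sub_left]
    exact h3

/-- Uniqueness of the Levi-Civita connection: the metric and torsion identities under cyclic
permutation of `i, j, k` form a linear system solved by the Koszul formula. It applies to whichever
connection the existential definitions supply. -/
theorem inner_nabla {nabla : CovariantDerivative (𝓡 n) (EuclideanSpace ℝ (Fin n))
    (fun x : M ↦ TangentSpace (𝓡 n) x)} (h : IsLeviCivita nabla) (i j k : κ) (x : M) :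
    inner ℝ (nabla (X j) x (X i x)) (X k x) = koszul X i j k x := by
  have : IsContMDiffRiemannianBundle (𝓡 n) 1 (EuclideanSpace ℝ (Fin n))
    (fun x : M ↦ TangentSpace (𝓡 n) x) := IsContMDiffRiemannianBundle.of_le (n := ∞) (by simp)
  have hm (i j k : κ) : inner ℝ (nabla (X j) x (X i x)) (X k x)
      + inner ℝ (nabla (X k) x (X i x)) (X j x) = 0 := by
    have h1 := h.1.mvfderiv_inner_eq (X i) (hX.mdifferentiableAt j x) (hX.mdifferentiableAt k x)
    rw [hX.mvfderiv_inner] at h1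
    rw [real_inner_comm (X j x)]
    exact h1.symm
  have ht (i j k : κ) : inner ℝ (nabla (X j) x (X i x)) (X k x)
      - inner ℝ (nabla (X i) x (X j x)) (X k x) = structureFunction X i j k x := by
    have h1 := nabla.torsion_eq_zero_iff.1 h.2 (hX.mdifferentiableAt i x)
      (hX.mdifferentiableAt j x)
    rw [structureFunction, ← h1, inner_sub_left]
  rw [koszul]
  linarith [hm i j k, hm j k i, hm k i j, ht i j k, ht j k i, ht k i j]

end IsSmoothOrthonormalFrame

end OrthonormalFrame

/-! ### The two conditions as equations on frame components -/

section FrameCriterion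

variable {n : ℕ} {M : Type*} [TopologicalSpace M] [ChartedSpace (EuclideanSpace ℝ (Fin n)) M]
  [IsManifold (𝓡 n) ∞ M] [RiemannianBundle (fun x : M ↦ TangentSpace (𝓡 n) x)]
  [IsContMDiffRiemannianBundle (𝓡 n) ∞ (EuclideanSpace ℝ (Fin n))
    (fun x : M ↦ TangentSpace (𝓡 n) x)]
  {κ : Type*} [Fintype κ] [DecidableEq κ]

namespace AlmostContactMetricStructure

variable (S : AlmostContactMetricStructure n M)
  (nabla : CovariantDerivative (𝓡 n) (EuclideanSpace ℝ (Fin n))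
    (fun x : M ↦ TangentSpace (𝓡 n) x))

theorem mdifferentiableAt_phiField {Y : (x : M) → TangentSpace (𝓡 n) x} {x : M}
    (hY : MDifferentiableAt (𝓡 n) (𝓡 n).tangent (fun y ↦ (⟨y, Y y⟩ : TangentBundle (𝓡 n) M)) x) :
    MDifferentiableAt (𝓡 n) (𝓡 n).tangent
      (fun y ↦ (⟨y, S.phiField Y y⟩ : TangentBundle (𝓡 n) M)) x :=
  MDifferentiableAt.clm_bundle_apply (S.smooth_phi.mdifferentiableAt (by simp)) hY

/-- In `∇(φ(fY)) - φ(∇(fY))` the two terms containing `df` are both `df ⊗ φY`, and they cancel. -/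
theorem tensorialAt_covDerivEndo (U : (x : M) → TangentSpace (𝓡 n) x) (x : M) :
    TensorialAt (𝓡 n) (EuclideanSpace ℝ (Fin n)) (V := fun x : M ↦ TangentSpace (𝓡 n) x)
      (covDerivEndo nabla S.phi U · x) x where
  smul {f Y} hf hY := by
    have h1 : (fun y ↦ S.phi y ((f • Y) y)) = f • S.phiField Y := by
      ext1 y
      exact map_smul (S.phi y) (f y) (Y y)
    rw [covDerivEndo, h1, nabla.isCovariantDerivativeOn.leibniz hY hf,
      nabla.isCovariantDerivativeOn.leibniz (S.mdifferentiableAt_phiField hY) hf, covDerivEndo]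
    simp [phiField, smul_sub]
    rfl
  add {Y Y'} hY hY' := by
    have h1 : (fun y ↦ S.phi y ((Y + Y') y)) = S.phiField Y + S.phiField Y' := by
      ext1 y
      exact map_add (S.phi y) (Y y) (Y' y)
    rw [covDerivEndo, h1, nabla.isCovariantDerivativeOn.add hY hY',
      nabla.isCovariantDerivativeOn.add (S.mdifferentiableAt_phiField hY)
        (S.mdifferentiableAt_phiField hY'), covDerivEndo, covDerivEndo]
    simp only [add_apply, map_add]
    exact add_sub_add_comm _ _ _ _

/-- The tensor `(u, v) ↦ (∇_u φ)(v)` at a point. -/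
def nablaPhi (x : M) :
    TangentSpace (𝓡 n) x →ₗ[ℝ] TangentSpace (𝓡 n) x →ₗ[ℝ] TangentSpace (𝓡 n) x :=
  LinearMap.mk₂ ℝ (fun u v ↦ TensorialAt.mkHom _ x
      (S.tensorialAt_covDerivEndo nabla (FiberBundle.extend (EuclideanSpace ℝ (Fin n)) u) x) v)
    (fun u u' v ↦ by
      simp only [TensorialAt.mkHom_apply_eq_extend, covDerivEndo, FiberBundle.extend_apply_self,
        map_add]
      exact add_sub_add_comm _ _ _ _)
    (fun c u v ↦ by
      simp only [TensorialAt.mkHom_apply_eq_extend, covDerivEndo, FiberBundle.extend_apply_self,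
        map_smul, smul_sub])
    (fun u v v' ↦ map_add _ _ _)
    (fun c u v ↦ map_smul _ _ _)

theorem nablaPhi_apply (U : (x : M) → TangentSpace (𝓡 n) x) {Y : (x : M) → TangentSpace (𝓡 n) x}
    {x : M}
    (hY : MDifferentiableAt (𝓡 n) (𝓡 n).tangent (fun y ↦ (⟨y, Y y⟩ : TangentBundle (𝓡 n) M)) x) :
    S.nablaPhi nabla x (U x) (Y x) = covDerivEndo nabla S.phi U Y x := by
  rw [nablaPhi, LinearMap.mk₂_apply, TensorialAt.mkHom_apply _ hY]
  simp only [covDerivEndo, FiberBundle.extend_apply_self]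

end AlmostContactMetricStructure

open AlmostContactMetricStructure

namespace IsSmoothOrthonormalFrame

variable {X : κ → (x : M) → TangentSpace (𝓡 n) x} (hX : IsSmoothOrthonormalFrame X)
  {S : AlmostContactMetricStructure n M} {ε : κ → ℝ} {τ : κ → κ}
  (hphi : ∀ j x, S.phi x (X j x) = ε j • X (τ j) x)
  (hskew : ∀ x u v, inner ℝ u (S.phi x v) = -inner ℝ (S.phi x u) v)
  {nabla : CovariantDerivative (𝓡 n) (EuclideanSpace ℝ (Fin n))
    (fun x : M ↦ TangentSpace (𝓡 n) x)} (hn : IsLeviCivita nabla)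

variable (X ε τ) in
/-- The components `g((∇_{X i} φ)(X j), X k)` when `φ (X j) = ε j • X (τ j)`. -/
def nablaPhiCoeff (i j k : κ) (x : M) : ℝ :=
  ε j * koszul X i (τ j) k x + ε k * koszul X i j (τ k) x

include hX hphi hskew hn

/-- Skewness moves the outer `φ` in `φ(∇Y)` onto `X k`, where it acts by `ε` and `τ`; the two minus
signs combine to the plus in `nablaPhiCoeff`. -/
theorem inner_nablaPhi (i j k : κ) (x : M) :
    inner ℝ (X k x) (S.nablaPhi nabla x (X i x) (X j x)) = nablaPhiCoeff X ε τ i j k x := by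
  have h1 : (fun y ↦ S.phi y (X j y)) = ε j • X (τ j) := by
    ext1 y
    exact hphi j y
  rw [S.nablaPhi_apply nabla (X i) (hX.mdifferentiableAt j x), covDerivEndo, h1,
    nabla.isCovariantDerivativeOn.smul_const _ (hX.mdifferentiableAt _ x), inner_sub_right,
    hskew, hphi, nablaPhiCoeff, smul_apply, inner_smul_right, inner_smul_left, real_inner_comm,
    hX.inner_nabla hn, real_inner_comm, hX.inner_nabla hn]
  simp

omit hn

/-- Polarization: a bilinear map vanishes on the diagonal if and only if it is skew, and skewness
can be checked on the frame. -/
theorem isNearlyCosymplectic_iff : S.IsNearlyCosymplectic ↔ ∀ i j k x,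
    nablaPhiCoeff X ε τ i j k x + nablaPhiCoeff X ε τ j i k x = 0 := by
  constructor
  · rintro ⟨nabla, hn, h⟩ i j k x
    have key (U : (x : M) → TangentSpace (𝓡 n) x) (hU : IsSmoothVectorField (𝓡 n) U) :
        S.nablaPhi nabla x (U x) (U x) = 0 := by
      rw [S.nablaPhi_apply nabla U (ContMDiff.mdifferentiableAt hU (by simp))]
      exact h U hU x
    have hij := key (X i + X j) ((hX.smooth i).add_section (hX.smooth j))
    rw [Pi.add_apply, map_add, map_add, LinearMap.add_apply, LinearMap.add_apply, 
      key _ (hX.smooth i), key _ (hX.smooth j), zero_add, add_zero] at hij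
    rw [← hX.inner_nablaPhi hphi hskew hn, ← hX.inner_nablaPhi hphi hskew hn, ← inner_add_right,
      add_comm, hij, inner_zero_right]
  · intro h
    refine ⟨hX.connection, hX.isLeviCivita_connection, fun U hU x ↦ ?_⟩
    rw [← S.nablaPhi_apply _ U (ContMDiff.mdifferentiableAt hU (by simp))]
    have hij (i j : κ) : S.nablaPhi hX.connection x (X i x) (X j x)
        = -S.nablaPhi hX.connection x (X j x) (X i x) := by
      refine hX.ext_inner fun k ↦ ?_
      rw [inner_neg_right, hX.inner_nablaPhi hphi hskew hX.isLeviCivita_connection,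
        hX.inner_nablaPhi hphi hskew hX.isLeviCivita_connection]
      linarith [h i j k x]
    obtain ⟨a, ha⟩ := hX.exists_eq_sum (U x)
    -- Exchanging the two summation indices turns the double sum into its own negative.
    have h2 : S.nablaPhi hX.connection x (U x) (U x)
        = -S.nablaPhi hX.connection x (U x) (U x) := by
      rw [ha]
      simp only [map_sum, LinearMap.sum_apply, map_smul, LinearMap.smul_apply, Finset.smul_sum]
      conv_rhs => rw [Finset.sum_comm]
      simp only [← Finset.sum_neg_distrib]
      refine Finset.sum_congr rfl fun i _ ↦ Finset.sum_congr rfl fun j _ ↦ ?_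
      rw [hij, smul_neg, smul_neg, smul_comm]
    refine hX.ext_inner fun k ↦ ?_
    have h3 := congrArg (inner ℝ (X k x)) h2
    rw [inner_neg_right] at h3
    rw [inner_zero_right]
    linarith

/-- Both sides are bilinear in the values of the two fields at the point, so frame fields suffice.
-/
theorem isQuasiCosymplectic_iff {o : κ} (hxi : S.xi = X o) : S.IsQuasiCosymplectic ↔ ∀ i j k x,
    nablaPhiCoeff X ε τ i j k x + ε i * ε j * nablaPhiCoeff X ε τ (τ i) (τ j) k x =
      (if o = j then 1 else 0) * (ε i * koszul X (τ i) o k x) := by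
  have key {nabla : CovariantDerivative (𝓡 n) (EuclideanSpace ℝ (Fin n))
      (fun x : M ↦ TangentSpace (𝓡 n) x)} (hn : IsLeviCivita nabla) (x : M) (i j : κ) :
      (S.nablaPhi nabla x (X i x) (X j x)
        + S.nablaPhi nabla x (S.phi x (X i x)) (S.phi x (X j x)) =
        inner ℝ (X o x) (X j x) • nabla (X o) x (S.phi x (X i x))) ↔ ∀ k, 
      nablaPhiCoeff X ε τ i j k x + ε i * ε j * nablaPhiCoeff X ε τ (τ i) (τ j) k x =
      (if o = j then 1 else 0) * (ε i * koszul X (τ i) o k x) := by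
    have h1 (k : κ) : inner ℝ (X k x) (S.nablaPhi nabla x (X i x) (X j x)
        + S.nablaPhi nabla x (S.phi x (X i x)) (S.phi x (X j x))) = 
        nablaPhiCoeff X ε τ i j k x + ε i * ε j * nablaPhiCoeff X ε τ (τ i) (τ j) k x := by
      rw [inner_add_right, hX.inner_nablaPhi hphi hskew hn, hphi, hphi, map_smul, map_smul,
        LinearMap.smul_apply, inner_smul_right, inner_smul_right,
        hX.inner_nablaPhi hphi hskew hn]
      ring
    have h2 (k : κ) : inner ℝ (X k x) (inner ℝ (X o x) (X j x) • nabla (X o) x (S.phi x (X i x)))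
        = (if o = j then 1 else 0) * (ε i * koszul X (τ i) o k x) := by
      rw [inner_smul_right, hphi, map_smul, inner_smul_right, hX.inner_eq, 
        real_inner_comm, hX.inner_nabla hn]
    constructor
    · intro h k
      rw [← h1, ← h2, h]
    · intro h
      exact hX.ext_inner fun k ↦ by rw [h1, h2, h]
  constructor
  · rintro ⟨nabla, hn, h⟩ i j k x
    refine (key hn x i j).1 ?_ k
    have h1 := h (X i) (X j) (hX.smooth i) (hX.smooth j) x
    rw [← S.nablaPhi_apply nabla (X i) (hX.mdifferentiableAt j x),
      ← S.nablaPhi_apply nabla _ (S.mdifferentiableAt_phiField (hX.mdifferentiableAt j x)),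
      hxi, eta, hxi] at h1
    exact h1
  · intro h
    refine ⟨hX.connection, hX.isLeviCivita_connection, fun U V hU hV x ↦ ?_⟩
    have hV' := ContMDiff.mdifferentiableAt hV (x := x) (by simp)
    rw [← S.nablaPhi_apply _ U hV',
      ← S.nablaPhi_apply _ _ (S.mdifferentiableAt_phiField hV'), hxi, eta, hxi]
    have hij (i j : κ) := (key hX.isLeviCivita_connection x i j).2 fun k ↦ h i j k x
    change S.nablaPhi hX.connection x (U x) (V x)
        + S.nablaPhi hX.connection x (S.phi x (U x)) (S.phi x (V x)) =
        inner ℝ (X o x) (V x) • hX.connection (X o) x (S.phi x (U x))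
    obtain ⟨a, ha⟩ := hX.exists_eq_sum (U x)
    obtain ⟨b, hb⟩ := hX.exists_eq_sum (V x)
    rw [ha, hb]
    simp only [map_sum, LinearMap.sum_apply, map_smul, LinearMap.smul_apply, inner_sum,
      inner_smul_right, Finset.sum_smul, Finset.smul_sum, ← Finset.sum_add_distrib]
    conv_rhs => rw [Finset.sum_comm]
    refine Finset.sum_congr rfl fun i _ ↦ Finset.sum_congr rfl fun j _ ↦ ?_
    rw [← smul_add, ← smul_add, hij]
    simp only [smul_smul]
    congr 1
    ring

end IsSmoothOrthonormalFrame

end FrameCriterion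

theorem ContinuousLinearMap.isInvertible_of_injective_of_finrank_eq {V W : Type*}
    [NormedAddCommGroup V] [NormedSpace ℝ V] [NormedAddCommGroup W] [NormedSpace ℝ W]
    [FiniteDimensional ℝ V] [FiniteDimensional ℝ W] {f : V →L[ℝ] W} (hf : Function.Injective f)
    (h : Module.finrank ℝ V = Module.finrank ℝ W) : f.IsInvertible :=
  ⟨(LinearEquiv.ofInjectiveOfFinrankEq f.toLinearMap hf h).toContinuousLinearEquiv, by ext; rfl⟩

/-! ### The frame dual to an adapted coframe -/

section AdaptedFrame

variable {M : Type*} [TopologicalSpace M] [ChartedSpace (EuclideanSpace ℝ (Fin 5)) M]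
  [IsManifold (𝓡 5) ∞ M] [RiemannianBundle (fun x : M ↦ TangentSpace (𝓡 5) x)]
  [IsContMDiffRiemannianBundle (𝓡 5) ∞ (EuclideanSpace ℝ (Fin 5))
    (fun x : M ↦ TangentSpace (𝓡 5) x)]

namespace AlmostContactMetricStructure.IsAdaptedCoframe

variable {S : AlmostContactMetricStructure 5 M}
  {θ : Fin 5 → (x : M) → TangentSpace (𝓡 5) x →L[ℝ] ℝ} (hS : S.IsAdaptedCoframe θ)
include hS

theorem eq_of_forall_apply_eq {x : M} {u v : TangentSpace (𝓡 5) x}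
    (h : ∀ i, θ i x u = θ i x v) : u = v := by
  rw [← sub_eq_zero, ← inner_self_eq_zero (𝕜 := ℝ), hS.inner_eq]
  simp [map_sub, h]

theorem isInvertible_pi (x : M) : (ContinuousLinearMap.pi fun i ↦ θ i x).IsInvertible := by
  refine ContinuousLinearMap.isInvertible_of_injective_of_finrank_eq
    (V := EuclideanSpace ℝ (Fin 5)) (fun u v h ↦ ?_) (by simp)
  exact hS.eq_of_forall_apply_eq fun i ↦ congrFun h i

/-- The fundamental form is a sum of wedge products, hence alternating, which is skewness of `φ`. -/
theorem inner_phi_right (x : M) (u v : TangentSpace (𝓡 5) x) :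
    inner ℝ u (S.phi x v) = -inner ℝ (S.phi x u) v := by
  have h1 := hS.fundamentalForm_eq x u v
  have h2 := hS.fundamentalForm_eq x v u
  rw [fundamentalForm] at h1 h2
  rw [real_inner_comm v, h1, h2]
  simp only [wedge]
  ring

variable {X : Fin 5 → (x : M) → TangentSpace (𝓡 5) x}
  (hθX : ∀ i j x, θ i x (X j x) = if i = j then 1 else 0)
include hθX

theorem inner_dualFrame (i : Fin 5) (x : M) (u : TangentSpace (𝓡 5) x) :
    inner ℝ (X i x) u = θ i x u := by
  simp [hS.inner_eq, hθX]

theorem isSmoothOrthonormalFrame (hX : ∀ i, IsSmoothVectorField (𝓡 5) (X i)) :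
    IsSmoothOrthonormalFrame X where
  smooth := hX
  inner_eq i j x := by rw [hS.inner_dualFrame hθX, hθX]
  sum_inner_smul x u := hS.eq_of_forall_apply_eq fun i ↦ by
    simp [map_sum, hS.inner_dualFrame hθX, hθX]

theorem phi_dualFrame (j : Fin 5) (x : M) :
    -- Since `g(X_k, φ X_j) = Φ(X_k, X_j)`, one has `φ X 0 = -X 1` and `φ X 1 = X 0`, and likewise
    -- for `X 2`, `X 3`. The sign `0` encodes `φ ξ = 0`, so the index `4` assigned to `4` is a dummy
    -- value.
    S.phi x (X j x) = (![-1, 1, -1, 1, 0] : Fin 5 → ℝ) j •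
      X ((![1, 0, 3, 2, 4] : Fin 5 → Fin 5) j) x := by
  refine hS.eq_of_forall_apply_eq fun k ↦ ?_
  have h := hS.fundamentalForm_eq x (X k x) (X j x)
  rw [fundamentalForm, hS.inner_dualFrame hθX] at h
  rw [h, map_smul]
  simp only [wedge, hθX]
  fin_cases j <;> fin_cases k <;> simp

theorem xi_eq_dualFrame : S.xi = X 4 := by
  ext1 x
  refine hS.eq_of_forall_apply_eq fun k ↦ ?_
  have h : S.eta x (X k x) = θ 4 x (X k x) := by rw [hS.eta_eq]
  rw [eta, innerSL_apply_apply, real_inner_comm, hS.inner_dualFrame hθX] at h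
  rw [h, hθX, hθX]
  simp [eq_comm]

/-- The functions `θ k (X j)` are constant, so only the bracket term of `dθ_k(X_i, X_j)` survives.
-/
theorem structureFunction_eq {k : Fin 5}
    {B : (x : M) → TangentSpace (𝓡 5) x → TangentSpace (𝓡 5) x → ℝ}
    (hB : IsExteriorDerivative (θ k) B) (hX : ∀ i, IsSmoothVectorField (𝓡 5) (X i))
    (i j : Fin 5) (x : M) :
    structureFunction X i j k x = -B x (X i x) (X j x) := by
  have h := hB x (X i) (X j) ((hX i).mdifferentiableAt (by simp))
    ((hX j).mdifferentiableAt (by simp))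
  simp only [hθX, mvfderiv_const] at h
  rw [structureFunction, real_inner_comm, hS.inner_dualFrame hθX, ← h]
  simp

end AlmostContactMetricStructure.IsAdaptedCoframe

end AdaptedFrame

/-! ### Component computations for the family -/

section FamilyAlgebra

open IsSmoothOrthonormalFrame

/-- The structure functions `g([X i, X j], X k)` of a frame dual to `e₁, …, e₅`, in terms of
`p = 2 a₁ + a₃`, `q = 2 a₂ + a₄`, `r = a₁ - a₃`, `s = a₂ - a₄` and the values `t` of `A₂` on the
frame. -/
def familyStructureFunction (p q r s : ℝ) (t : Fin 5 → ℝ) (i j k : Fin 5) : ℝ :=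
  let δ (a b : Fin 5) : ℝ := if a = b then 1 else 0
  let A (b : Fin 5) : ℝ := t i * δ b j - t j * δ b i
  let W (a b : Fin 5) : ℝ := δ a i * δ b j - δ a j * δ b i;
  -(![A 1 - p * W 2 4 - q * W 3 4, -A 0 + p * W 3 4 - q * W 2 4, -A 3 + p * W 0 4 + q * W 1 4,
    A 2 - p * W 1 4 + q * W 0 4,
    -2 * r * (W 0 2 - W 1 3) - 2 * s * (W 0 3 + W 1 2)] : Fin 5 → ℝ) k

variable {M : Type*} [TopologicalSpace M] [ChartedSpace (EuclideanSpace ℝ (Fin 5)) M]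
  [RiemannianBundle (fun x : M ↦ TangentSpace (𝓡 5) x)]
  {X : Fin 5 → (x : M) → TangentSpace (𝓡 5) x} {p q r s : ℝ} {t : Fin 5 → M → ℝ}
  (h : ∀ i j k x, structureFunction X i j k x
    = familyStructureFunction p q r s (fun i ↦ t i x) i j k)
include h

set_option maxHeartbeats 4000000 in
theorem nablaPhiCoeff_symm_eq_zero_iff [Nonempty M] :
    (∀ i j k x, nablaPhiCoeff X ![-1, 1, -1, 1, 0] ![1, 0, 3, 2, 4] i j k x
      + nablaPhiCoeff X ![-1, 1, -1, 1, 0] ![1, 0, 3, 2, 4] j i k x = 0) ↔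
    2 * p = 3 * r ∧ 2 * q = 3 * s := by
  constructor
  · intro H
    obtain ⟨x⟩ := ‹Nonempty M›
    -- These two components suffice: they read `2p - 3r = 0` and its analogue for `q` and `s`.
    have h1 := H 0 4 3 x
    have h2 := H 0 4 2 x
    simp [nablaPhiCoeff, koszul, h, familyStructureFunction] at h1 h2
    constructor <;> linarith
  · rintro ⟨h1, h2⟩ i j k x
    obtain rfl : p = 3 / 2 * r := by linarith
    obtain rfl : q = 3 / 2 * s := by linarith
    fin_cases i <;> fin_cases j <;> fin_cases k <;>
      (simp [nablaPhiCoeff, koszul, h, familyStructureFunction]; try ring)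

set_option maxHeartbeats 4000000 in
theorem nablaPhiCoeff_quasi_iff [Nonempty M] :
    (∀ i j k x, nablaPhiCoeff X ![-1, 1, -1, 1, 0] ![1, 0, 3, 2, 4] i j k x
      + (![-1, 1, -1, 1, 0] : Fin 5 → ℝ) i * (![-1, 1, -1, 1, 0] : Fin 5 → ℝ) j *
        nablaPhiCoeff X ![-1, 1, -1, 1, 0] ![1, 0, 3, 2, 4] ((![1, 0, 3, 2, 4] : Fin 5 → Fin 5) i)
          ((![1, 0, 3, 2, 4] : Fin 5 → Fin 5) j) k x =
      (if 4 = j then 1 else 0) * ((![-1, 1, -1, 1, 0] : Fin 5 → ℝ) i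
        * koszul X ((![1, 0, 3, 2, 4] : Fin 5 → Fin 5) i) 4 k x)) ↔ p = r ∧ q = s := by
  constructor
  · intro H
    obtain ⟨x⟩ := ‹Nonempty M›
    -- For `i = 4` the sign `ε 4 = 0` removes the second term and `j = 0` removes the right side.
    -- What remains is part of `∇_ξ φ = 0`, giving `p = r` and then `q = s`.
    have h1 := H 4 0 3 x
    have h2 := H 4 0 2 x
    simp [nablaPhiCoeff, koszul, h, familyStructureFunction] at h1 h2
    constructor <;> linarith
  · rintro ⟨rfl, rfl⟩ i j k x
    fin_cases i <;> fin_cases j <;> fin_cases k <;>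
      (simp [nablaPhiCoeff, koszul, h, familyStructureFunction]; try ring)

end FamilyAlgebra

end

/-! ### From the structure equations on the group to the submanifold -/

theorem structureFunction_eq_familyStructureFunction {a₁ a₂ a₃ a₄ : ℝ}
    {N : Type*} [TopologicalSpace N] [ChartedSpace (EuclideanSpace ℝ (Fin 6)) N]
    [IsManifold (𝓡 6) ∞ N] {e : Fin 6 → (x : N) → TangentSpace (𝓡 6) x →L[ℝ] ℝ}
    (hsm : ∀ i, IsSmoothOneForm (𝓡 6) (e i)) (he : StructureEquations a₁ a₂ a₃ a₄ e)
    {M : Type*} [TopologicalSpace M] [ChartedSpace (EuclideanSpace ℝ (Fin 5)) M]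
    [IsManifold (𝓡 5) ∞ M] {ι : M → N} (hι : ContMDiff (𝓡 5) (𝓡 6) ∞ ι)
    [RiemannianBundle (fun x : M ↦ TangentSpace (𝓡 5) x)]
    [IsContMDiffRiemannianBundle (𝓡 5) ∞ (EuclideanSpace ℝ (Fin 5))
      (fun x : M ↦ TangentSpace (𝓡 5) x)]
    {S : AlmostContactMetricStructure 5 M}
    (hS : S.IsAdaptedCoframe fun i ↦ pullbackOneForm ι (e i.castSucc))
    {X : Fin 5 → (x : M) → TangentSpace (𝓡 5) x} (hX : ∀ i, IsSmoothVectorField (𝓡 5) (X i))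
    (hθX : ∀ i j x, pullbackOneForm ι (e i.castSucc) x (X j x) = if i = j then 1 else 0)
    (i j k : Fin 5) (x : M) :
    structureFunction X i j k x = familyStructureFunction (2 * a₁ + a₃) (2 * a₂ + a₄) (a₁ - a₃)
      (a₂ - a₄) (fun i ↦ pullbackOneForm ι (e 5) x (X i x)) i j k := by
  have h0 (j x) : e 0 (ι x) (mfderiv (𝓡 5) (𝓡 6) ι x (X j x)) = if 0 = j then 1 else 0 := hθX 0 j x
  have h1 (j x) : e 1 (ι x) (mfderiv (𝓡 5) (𝓡 6) ι x (X j x)) = if 1 = j then 1 else 0 := hθX 1 j x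
  have h2 (j x) : e 2 (ι x) (mfderiv (𝓡 5) (𝓡 6) ι x (X j x)) = if 2 = j then 1 else 0 := hθX 2 j x
  have h3 (j x) : e 3 (ι x) (mfderiv (𝓡 5) (𝓡 6) ι x (X j x)) = if 3 = j then 1 else 0 := hθX 3 j x
  have h4 (j x) : e 4 (ι x) (mfderiv (𝓡 5) (𝓡 6) ι x (X j x)) = if 4 = j then 1 else 0 := hθX 4 j x
  have hB {k : Fin 5} {B} (h : IsExteriorDerivative (e k.castSucc) B) :=
    hS.structureFunction_eq hθX (IsExteriorDerivative.pullback hι (hsm _) h) hX i j x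
  have ht (j) : pullbackOneForm ι (e 5) x (X j x)
    = e 5 (ι x) (mfderiv (𝓡 5) (𝓡 6) ι x (X j x)) := rfl
  fin_cases k
  · refine (hB (k := 0) he.d_e₁).trans ?_
    simp [wedge, familyStructureFunction, h1, h2, h3, h4, ht]
  · refine (hB (k := 1) he.d_e₂).trans ?_
    simp [wedge, familyStructureFunction, h0, h2, h3, h4, ht]
  · refine (hB (k := 2) he.d_e₃).trans ?_
    simp [wedge, familyStructureFunction, h0, h1, h3, h4, ht]
  · refine (hB (k := 3) he.d_e₄).trans ?_
    simp [wedge, familyStructureFunction, h0, h1, h2, h4, ht]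
  · refine (hB (k := 4) he.d_e₅).trans ?_
    simp [wedge, familyStructureFunction, h0, h1, h2, h3, ht]

theorem mainTheorem12 (a₁ a₂ a₃ a₄ : ℝ) (ha : a₁ * a₄ = a₂ * a₃)
    {G : Type*} [TopologicalSpace G] [ChartedSpace (EuclideanSpace ℝ (Fin 6)) G] [Group G]
    [LieGroup (𝓡 6) ∞ G]
    -- `e₁, …, e₅, A₂` are a basis of the left-invariant one-forms on the Lie group `G`
    (e : Module.Basis (Fin 6) ℝ (leftInvariantOneForms (𝓡 6) G))
    (he : StructureEquations a₁ a₂ a₃ a₄ fun i ↦ (e i).1)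
    {M : Type*} [TopologicalSpace M] [ChartedSpace (EuclideanSpace ℝ (Fin 5)) M]
    [IsManifold (𝓡 5) ∞ M] [Nonempty M]
    -- `M` is a submanifold of `G` on which the restrictions of `e₁, …, e₅` are independent
    (ι : M → G) (hι : IsImmersion (𝓡 5) (𝓡 6) ∞ ι) (hinj : Function.Injective ι)
    (hind : ∀ x : M, LinearIndependent ℝ
      fun i : Fin 5 ↦ pullbackOneForm ι (e i.castSucc).1 x)
    -- the Riemannian metric and the almost contact metric structure of `M`
    [RiemannianBundle (fun x : M ↦ TangentSpace (𝓡 5) x)]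
    [IsContMDiffRiemannianBundle (𝓡 5) ∞ (EuclideanSpace ℝ (Fin 5))
      (fun x : M ↦ TangentSpace (𝓡 5) x)]
    (S : AlmostContactMetricStructure 5 M)
    (hS : S.IsAdaptedCoframe fun i ↦ pullbackOneForm ι (e i.castSucc).1) :
    (S.IsNearlyCosymplectic ↔ a₁ = -5 * a₃ ∧ a₂ = -5 * a₄) ∧
    (S.IsQuasiCosymplectic ↔ a₁ = -2 * a₃ ∧ a₂ = -2 * a₄) := by
  have hsm (i : Fin 6) : IsSmoothOneForm (𝓡 6) (e i).1 := (e i).2.1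
  obtain ⟨X, hX, hθX⟩ := exists_smooth_dualFrame
    (θ := fun i : Fin 5 ↦ pullbackOneForm ι (e i.castSucc).1)
    (fun i x₀ ↦ (hsm i.castSucc).contDiffAt_coordForm_pullback hι.contMDiff x₀)
    hS.isInvertible_pi
  have hF := hS.isSmoothOrthonormalFrame hθX hX
  have hc := structureFunction_eq_familyStructureFunction hsm he hι.contMDiff hS hX hθX
  rw [hF.isNearlyCosymplectic_iff (hS.phi_dualFrame hθX) hS.inner_phi_right,
    hF.isQuasiCosymplectic_iff (hS.phi_dualFrame hθX) hS.inner_phi_right (hS.xi_eq_dualFrame hθX),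
    nablaPhiCoeff_symm_eq_zero_iff (t := fun i x ↦ pullbackOneForm ι (e 5).1 x (X i x)) hc,
    nablaPhiCoeff_quasi_iff (t := fun i x ↦ pullbackOneForm ι (e 5).1 x (X i x)) hc]
  -- Here `2(2a₁ + a₃) = 3(a₁ - a₃)` amounts to `a₁ = -5a₃`, and `2a₁ + a₃ = a₁ - a₃` to `a₁ =
  -- -2a₃`; the same holds for `a₂`, `a₄`.
  refine ⟨⟨fun h ↦ ?_, fun h ↦ ?_⟩, ⟨fun h ↦ ?_, fun h ↦ ?_⟩⟩ <;>
    constructor <;> linarith [h.1, h.2]
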